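/- Let $\Gamma$ be a countable group. A p.m.p. action $\Gamma\curvearrowright (X,\mu)$ is an action of $\Gamma$ on a standard Borel space $X$ by Borel automorphisms preserving a Borel probability measure $\mu$; it is ergodic if every Borel set $A\subseteq X$ with $\mu(\gamma^{-1}A\,\triangle\, A)=0$ for all $\gamma\in\Gamma$ satisfies $\mu(A)\in\{0,1\}$. Given actions of $\Gamma$ on probability spaces $(X,\mu)$ and $(Y,\nu)$ by measurable measure preserving transformations, a factor map from $\Gamma\curvearrowright(Y,\nu)$ to $\Gamma\curvearrowright(X,\mu)$ is a measurable, measure preserving map $\theta:Y\to X$ such that $\theta(\gamma y)=\gamma\theta(y)$ for all $\gamma\in\Gamma$ and $\nu$-almost every $y\in Y$; if such a map exists, $\Gamma\curvearrowright(X,\mu)$ is a factor of $\Gamma\curvearrowright(Y,\nu)$. If in addition there is a factor map $\theta$ that is one-to-one on some $\nu$-conull subset of $Y$, then $\Gamma\curvearrowright(X,\mu)$ is isomorphic to $\Gamma\curvearrowright(Y,\nu)$. Two actions are weakly isomorphic if each is a factor of the other. An ergodic p.m.p. action $\Gamma\curvearrowright(X,\mu)$ is compact if there are a compact (Hausdorff)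 group $K$, a closed subgroup $L<K$ and a homomorphism $\rho:\Gamma\to K$ such that $\Gamma\curvearrowright(X,\mu)$ is isomorphic to the action $\gamma\cdot kL=\rho(\gamma)kL$ on $(K/L,m_{K/L})$, where $K/L$ carries its Borel $\sigma$-algebra and $m_{K/L}$ is the $K$-invariant probability measure on $K/L$ obtained as the image of the normalised Haar measure of $K$. Let $\Gamma\curvearrowright^{\alpha}(X,\mu)$ and $\Gamma\curvearrowright^{\beta}(Y,\nu)$ be ergodic compact p.m.p. actions of $\Gamma$. If $\alpha$ and $\beta$ are weakly isomorphic, then $\alpha$ is isomorphic to $\beta$. -/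

import Mathlib

open MeasureTheory Set

universe u v w k₁ k₂

/-- `θ : Y → X` is a factor map from `Γ ↷ (Y, ν)` onto `Γ ↷ (X, μ)`: it is measurable and measure
preserving and, for every `γ`, it satisfies `θ (γ y) = γ θ(y)` for almost every `y`. -/
structure IsFactorMap (Γ : Type*) {X Y : Type*} [SMul Γ X] [SMul Γ Y]
    [MeasurableSpace X] [MeasurableSpace Y] (μ : Measure X) (ν : Measure Y) (θ : Y → X) :
    Prop where
  measurePreserving : MeasurePreserving θ ν μ
  equivariant : ∀ γ : Γ, ∀ᵐ y ∂ν, θ (γ • y) = γ • θ y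

/-- `Γ ↷ (X, μ)` is a factor of `Γ ↷ (Y, ν)`. -/
def IsFactor (Γ : Type*) {X Y : Type*} [SMul Γ X] [SMul Γ Y]
    [MeasurableSpace X] [MeasurableSpace Y] (μ : Measure X) (ν : Measure Y) : Prop :=
  ∃ θ : Y → X, IsFactorMap Γ μ ν θ

/-- `Γ ↷ (X, μ)` is isomorphic to `Γ ↷ (Y, ν)`: there is a factor map `θ : Y → X` which is
one-to-one on a conull subset of `Y`. -/
def IsIsomorphic (Γ : Type*) {X Y : Type*} [SMul Γ X] [SMul Γ Y]
    [MeasurableSpace X] [MeasurableSpace Y] (μ : Measure X) (ν : Measure Y) : Prop :=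
  ∃ θ : Y → X, IsFactorMap Γ μ ν θ ∧ ∃ Y₀ : Set Y, ν Y₀ᶜ = 0 ∧ InjOn θ Y₀

/-- Each of the two actions is a factor of the other. -/
def IsWeaklyIsomorphic (Γ : Type*) {X Y : Type*} [SMul Γ X] [SMul Γ Y]
    [MeasurableSpace X] [MeasurableSpace Y] (μ : Measure X) (ν : Measure Y) : Prop :=
  IsFactor Γ μ ν ∧ IsFactor Γ ν μ

/-- The space `K ⧸ L` of left cosets, on which `Γ` acts by translation via a homomorphism
`ρ : Γ →* K`. -/
def TranslationSpace {Γ K : Type*} [Group Γ] [Group K] (_ρ : Γ →* K) (L : Subgroup K) : Type _ :=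
  K ⧸ L

namespace TranslationSpace

variable {Γ K : Type*} [Group Γ] [Group K] (ρ : Γ →* K) (L : Subgroup K)

/-- The quotient map `K → K ⧸ L`, `k ↦ kL`. -/
def mk (k : K) : TranslationSpace ρ L := (k : K ⧸ L)

/-- The action `γ • kL = ρ(γ)kL`. -/
instance : MulAction Γ (TranslationSpace ρ L) := MulAction.compHom (K ⧸ L) ρ

/-- The quotient topology. -/
instance [TopologicalSpace K] : TopologicalSpace (TranslationSpace ρ L) :=
  inferInstanceAs (TopologicalSpace (K ⧸ L))

/-- The Borel sets of the quotient topology. -/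
instance [TopologicalSpace K] : MeasurableSpace (TranslationSpace ρ L) :=
  borel (TranslationSpace ρ L)

/-- The invariant probability measure `m_{K/L}` on `K ⧸ L`, for a compact group `K`: the image of
the normalised (total mass one) Haar measure of `K` under `k ↦ kL`. -/
noncomputable def invariantMeasure [TopologicalSpace K] [IsTopologicalGroup K] [CompactSpace K] :
    Measure (TranslationSpace ρ L) :=
  letI : MeasurableSpace K := borel K
  haveI : BorelSpace K := ⟨rfl⟩
  (Measure.haarMeasure (⊤ : TopologicalSpace.PositiveCompacts K)).map (mk ρ L)

end TranslationSpace

/-- `Γ ↷ (X, μ)` is a compact action: it is isomorphic to the action of `Γ` on `(K/L, m_{K/L})` by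
translations via a homomorphism `ρ : Γ → K`, for some compact (Hausdorff) group `K` and some
closed subgroup `L` of `K`. (A cocycle of `Γ` over a one-point space with values in `K` is the same
thing as a homomorphism `Γ → K`.) -/
def IsCompactAction (Γ : Type u) [Group Γ] {X : Type v} [MulAction Γ X] [MeasurableSpace X]
    (μ : Measure X) : Prop :=
  ∃ (K : Type w) (_ : Group K) (_ : TopologicalSpace K) (_ : IsTopologicalGroup K)
    (_ : CompactSpace K) (_ : T2Space K) (L : Subgroup K) (_ : IsClosed (L : Set K))
    (ρ : Γ →* K), IsIsomorphic Γ μ (TranslationSpace.invariantMeasure ρ L)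

/-! The composite `τ = φ ∘ θ` of the two factor maps is an equivariant self-map of `Y`; if `τ` is
injective on a conull set, so is `θ`. Let `U` be the isometry `f ↦ f ∘ τ` of `L²(Y)`. If `U` is
onto, a bounded injective function on `Y` factors through `τ` almost everywhere, so `τ` is injective
there (`exists_conull_injOn_of_surjective`).

Otherwise compactness gives a nonzero finite-dimensional invariant `V` orthogonal to the range of
`U` (`IsFactor.exists_finiteDimensional_invariant_le`). The spaces `Uⁱ V` are pairwise orthogonal
copies of one representation of dimension `d`. By ergodicity its multiplicity is at most `d`:
evaluating the copies at a generic point gives nonzero orthogonal vectors of `ℝᵈ`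
(`eq_bot_of_le_orthogonal_range`), a contradiction. -/

/-! ### Averaging over a compact group -/

/-- A nonzero closed subspace which is invariant under a continuous isometric representation of a
compact group contains a nonzero finite-dimensional invariant subspace. -/
theorem exists_finiteDimensional_invariant_le {E H : Type*} [NormedAddCommGroup E]
    [InnerProductSpace ℝ E] [CompleteSpace E] [Group H] [TopologicalSpace H] [IsTopologicalGroup H]
    [CompactSpace H] (π : H →* (E →ₗᵢ[ℝ] E)) (hπ : ∀ v, Continuous fun h ↦ π h v)
    (W : Submodule ℝ E) (hW : IsClosed (W : Set E)) (hinv : ∀ h, ∀ w ∈ W, π h w ∈ W)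
    (hne : W ≠ ⊥) :
    ∃ V ≤ W, V ≠ ⊥ ∧ FiniteDimensional ℝ V ∧ ∀ h, ∀ v ∈ V, π h v ∈ V := by
  obtain ⟨w, hwW, hw⟩ := W.exists_mem_ne_zero_of_ne_bot hne
  borelize H
  let m : Measure H := Measure.haarMeasure (⊤ : TopologicalSpace.PositiveCompacts H)
  have : IsProbabilityMeasure m := ⟨Measure.haarMeasure_self⟩
  -- The Haar average `T` of these rank-one operators is compact, symmetric, commutes with `π` and
  -- maps into `W`; its eigenspaces for nonzero eigenvalues are the required subspaces.
  let F : H → E →L[ℝ] E := fun h ↦ InnerProductSpace.rankOne ℝ (π h w) (π h w)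
  have hF : Continuous F := ((InnerProductSpace.rankOne ℝ).continuous.comp (hπ w)).clm_apply (hπ w)
  have hint {A : Type _} [NormedAddCommGroup A] {f : H → A} (hf : Continuous f) :
      Integrable f m := hf.integrable_of_hasCompactSupport (.of_compactSpace f)
  let T : E →L[ℝ] E := ∫ h, F h ∂m
  have hT_apply (x : E) : T x = ∫ h, inner ℝ (π h w) x • π h w ∂m := by
    simp only [T]
    rw [ContinuousLinearMap.integral_apply (hint hF)]
    simp [F]
  have hcont (x : E) : Continuous fun h ↦ inner ℝ (π h w) x • π h w := by
    have := hπ w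
    fun_prop
  have hT_inner (x y : E) : inner ℝ (T x) y = ∫ h, inner ℝ (π h w) x * inner ℝ (π h w) y ∂m := by
    rw [hT_apply, real_inner_comm, ← integral_inner (hint (hcont x))]
    refine integral_congr_ae (.of_forall fun h ↦ ?_)
    simp [inner_smul_right, real_inner_comm]
  have hT_compact : IsCompactOperator T := by
    have hc : Convex ℝ (compactOperator (RingHom.id ℝ) E E : Set (E →L[ℝ] E)) :=
      (compactOperator (RingHom.id ℝ) E E).convex
    refine hc.integral_mem (μ := m) isClosed_setOfPred_isCompactOperator
      (.of_forall fun h ↦ ?_) (hint hF)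
    have h1 : IsCompactOperator (innerSL ℝ (π h w)) :=
      isCompactOperator_of_locallyCompactSpace_dom (innerSL ℝ (π h w))
    exact h1.clm_comp (ContinuousLinearMap.toSpanSingleton ℝ (π h w))
  have hT_symm : T.IsSymmetric := fun x y ↦ by
    rw [ContinuousLinearMap.coe_coe, hT_inner, real_inner_comm, hT_inner]
    simp only [mul_comm]
  have hT_comm (g : H) (x : E) : T (π g x) = π g (T x) := by
    rw [hT_apply, hT_apply]
    change _ = (π g).toContinuousLinearMap _
    -- Substitute `g * h` for `h` by left invariance of Haar measure.
    rw [← ContinuousLinearMap.integral_comp_comm _ (hint (hcont x)),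
      ← integral_mul_left_eq_self _ g]
    simp
  have hT_mem (x : E) : T x ∈ W := by
    rw [hT_apply]
    exact W.convex.integral_mem hW (.of_forall fun h ↦ W.smul_mem _ (hinv h w hwW)) (hint (hcont x))
  have hT_ne : T ≠ 0 := by
    intro h0
    have hpos : 0 < inner ℝ (T w) w := by
      rw [hT_inner]
      refine Continuous.integral_pos_of_hasCompactSupport_nonneg_nonzero (x := 1) ?_
        (.of_compactSpace _) (fun h ↦ mul_self_nonneg _) ?_
      · have := hπ w
        fun_prop
      · simpa using hw
    simp [h0] at hpos
  obtain ⟨c, hc, hc0⟩ : ∃ c, Module.End.HasEigenvalue (T : Module.End ℝ E) c ∧ c ≠ 0 := by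
    by_contra! h
    exact hT_ne ((T.eq_zero_of_forall_hasEigenvalue_eq_zero hT_compact hT_symm).1 h)
  refine ⟨Module.End.eigenspace T.toLinearMap c, fun v hv ↦ ?_, hc,
    T.finite_dimensional_eigenspace hT_compact c hc0, fun h v hv ↦ ?_⟩
  · have h1 : T v = c • v := Module.End.mem_eigenspace_iff.1 hv
    rw [← inv_smul_smul₀ hc0 v, ← h1]
    exact W.smul_mem _ (hT_mem v)
  · rw [Module.End.mem_eigenspace_iff] at hv ⊢
    change T v = c • v at hv
    change T _ = _
    rw [hT_comm, hv, map_smul]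

/-! ### Ergodicity bounds multiplicity -/

/-- Preimages of measurable sets are almost invariant, hence null or conull; a countable separating
family then pins down the value. -/
theorem exists_ae_eq_const_of_forall_smul_ae_eq {Γ Y β : Type*} [SMul Γ Y] [MeasurableSpace Y]
    {ν : Measure Y} [ErgodicSMul Γ Y ν] [Nonempty β] [MeasurableSpace β]
    [MeasurableSpace.CountablySeparated β] {g : Y → β} (hg : NullMeasurable g ν)
    (h : ∀ γ : Γ, ∀ᵐ y ∂ν, g (γ • y) = g y) : ∃ c, ∀ᵐ y ∂ν, g y = c := by
  refine Filter.exists_eventuallyEq_const_of_forall_separating MeasurableSet fun U hU ↦ ?_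
  have := aeconst_of_forall_preimage_smul_ae_eq Γ (hg hU) fun γ ↦
    ((h γ).mono fun y hy ↦ by simp only [mem_preimage, hy]).set_eq
  exact Filter.eventuallyConst_set.1 this

/-- Summing products over an orthonormal basis is invariant under changing that basis
orthogonally. -/
theorem sum_mul_eq_of_orthogonal {ι : Type*} [Fintype ι] [DecidableEq ι] {A : Matrix ι ι ℝ}
    (hA : A * A.transpose = 1) (u v : ι → ℝ) :
    ∑ j, (∑ l, A j l * u l) * (∑ l, A j l * v l) = ∑ j, u j * v j := by
  change dotProduct (A.mulVec u) (A.mulVec v) = dotProduct u v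
  rw [Matrix.dotProduct_mulVec, Matrix.vecMul_mulVec, mul_eq_one_comm.1 hA, Matrix.vecMul_one]

/-- The images under the powers of an isometry `U` of a subspace orthogonal to the range of `U` are
pairwise orthogonal. -/
theorem inner_iterate_eq_zero {E : Type*} [NormedAddCommGroup E] [InnerProductSpace ℝ E]
    (U : E →ₗᵢ[ℝ] E) {V : Submodule ℝ E} (hV : V ≤ (LinearMap.range U.toLinearMap)ᗮ)
    {a b : E} (ha : a ∈ V) (hb : b ∈ V) {i k : ℕ} (hik : i ≠ k) :
    inner ℝ (U^[i] a) (U^[k] b) = 0 := by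
  have key : ∀ n (x y : E), inner ℝ (U^[n] x) (U^[n] y) = inner ℝ x y := by
    intro n
    induction n with
    | zero => simp
    | succ n ih => intro x y; rw [Function.iterate_succ_apply, Function.iterate_succ_apply, ih]; simp
  have aux : ∀ {a b : E} {i k : ℕ}, a ∈ V → i < k → inner ℝ (U^[i] a) (U^[k] b) = 0 := by
    intro a b i k ha hik
    obtain ⟨n, rfl⟩ := Nat.exists_eq_add_of_lt hik
    -- Cancelling `Uⁱ` leaves `a` against a vector in the range of `U`.
    rw [add_assoc, Function.iterate_add_apply, key, Function.iterate_succ_apply']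
    exact Submodule.inner_left_of_mem_orthogonal (LinearMap.mem_range_self U.toLinearMap _) (hV ha)
  rcases lt_or_gt_of_ne hik with h | h
  · exact aux ha h
  · rw [real_inner_comm]; exact aux hb h

/-- Nonzero orthogonal vectors are linearly independent. -/
theorem card_le_of_sum_mul_eq {d m : ℕ} (w : Fin m → Fin d → ℝ) {c : ℝ} (hc : c ≠ 0)
    (h : ∀ i k, ∑ j, w i j * w k j = if i = k then c else 0) : m ≤ d := by
  have hv (i k : Fin m) : inner ℝ (WithLp.toLp 2 (w i) : EuclideanSpace ℝ (Fin d))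
      (WithLp.toLp 2 (w k)) = if i = k then c else 0 := by
    rw [← h, PiLp.inner_apply]
    exact Finset.sum_congr rfl fun j _ ↦ Real.inner_apply _ _
  have hli : LinearIndependent ℝ fun i ↦ (WithLp.toLp 2 (w i) : EuclideanSpace ℝ (Fin d)) := by
    refine linearIndependent_of_ne_zero_of_inner_eq_zero (𝕜 := ℝ) (fun i hi ↦ ?_) fun i k hik ↦ ?_
    · have := hv i i
      rw [hi, inner_zero_left, if_pos rfl] at this
      exact hc this.symm
    · exact (hv i k).trans (if_neg hik)
  simpa using hli.fintype_card_le_finrank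

/-- Over an ergodic action, a finite-dimensional invariant subspace of `L²` which is orthogonal to
the range of an equivariant isometry `U` vanishes: otherwise its images under the powers of `U`
would be infinitely many orthogonal copies of the same representation. -/
theorem eq_bot_of_le_orthogonal_range {Γ Y : Type*} [SMul Γ Y] [MeasurableSpace Y]
    {ν : Measure Y} [IsProbabilityMeasure ν] [ErgodicSMul Γ Y ν]
    (hsm : ∀ γ : Γ, MeasurePreserving (γ • · : Y → Y) ν ν)
    (U : Lp ℝ 2 ν →ₗᵢ[ℝ] Lp ℝ 2 ν)
    (hU : ∀ γ f, U (Lp.compMeasurePreserving _ (hsm γ) f) = Lp.compMeasurePreserving _ (hsm γ) (U f))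
    (V : Submodule ℝ (Lp ℝ 2 ν)) [FiniteDimensional ℝ V]
    (hV : V ≤ (LinearMap.range U.toLinearMap)ᗮ)
    (hinv : ∀ γ, ∀ f ∈ V, Lp.compMeasurePreserving _ (hsm γ) f ∈ V) : V = ⊥ := by
  by_contra hne
  let e := stdOrthonormalBasis ℝ V
  set d := Module.finrank ℝ V with hd
  have hd0 : d ≠ 0 := fun h ↦ hne (Submodule.finrank_eq_zero.1 h)
  let A (γ : Γ) : Matrix (Fin d) (Fin d) ℝ := fun j l ↦
    inner ℝ (e l : Lp ℝ 2 ν) (Lp.compMeasurePreserving _ (hsm γ) (e j : Lp ℝ 2 ν))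
  have hexp (γ : Γ) (j : Fin d) :
      Lp.compMeasurePreserving _ (hsm γ) (e j : Lp ℝ 2 ν) = ∑ l, A γ j l • (e l : Lp ℝ 2 ν) := by
    have := congrArg (Subtype.val : V → Lp ℝ 2 ν) (e.sum_repr' ⟨_, hinv γ _ (e j).2⟩)
    simpa [A] using this.symm
  have horth (γ : Γ) : A γ * (A γ).transpose = 1 := by
    ext j k
    have h1 : inner ℝ (Lp.compMeasurePreservingₗᵢ ℝ _ (hsm γ) (e j : Lp ℝ 2 ν))
        (Lp.compMeasurePreservingₗᵢ ℝ _ (hsm γ) (e k : Lp ℝ 2 ν)) = if j = k then (1 : ℝ) else 0 := by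
      rw [LinearIsometry.inner_map_map]
      exact orthonormal_iff_ite.1 e.orthonormal j k
    change inner ℝ (Lp.compMeasurePreserving _ (hsm γ) (e j : Lp ℝ 2 ν))
      (Lp.compMeasurePreserving _ (hsm γ) (e k : Lp ℝ 2 ν)) = _ at h1
    rw [hexp γ k, inner_sum] at h1
    simp only [inner_smul_right, Matrix.mul_apply, Matrix.one_apply, Matrix.transpose_apply] at h1 ⊢
    rw [← h1]
    refine Finset.sum_congr rfl fun l _ ↦ ?_
    rw [mul_comm, real_inner_comm]
  let w (i : ℕ) (j : Fin d) : Lp ℝ 2 ν := U^[i] (e j)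
  -- Since `U` commutes with the action, every copy has the same matrix `A γ`.
  have hwexp (γ : Γ) (i : ℕ) (j : Fin d) :
      Lp.compMeasurePreserving _ (hsm γ) (w i j) = ∑ l, A γ j l • w i l := by
    induction i with
    | zero => exact hexp γ j
    | succ i ih =>
      simp only [w, Function.iterate_succ_apply'] at ih ⊢
      rw [← hU, ih]
      simp
  have hwae (γ : Γ) (i : ℕ) (j : Fin d) : ∀ᵐ y ∂ν, w i j (γ • y) = ∑ l, A γ j l * w i l y := by
    filter_upwards [Lp.coeFn_compMeasurePreserving (w i j) (hsm γ),
      Lp.coeFn_finsetSum Finset.univ (fun l ↦ A γ j l • w i l),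
      ae_all_iff.2 fun l ↦ Lp.coeFn_smul (A γ j l) (w i l)] with y h1 h2 h3
    rw [hwexp, h2, Finset.sum_apply] at h1
    simp only [h3, Function.comp_apply, Pi.smul_apply, smul_eq_mul] at h1
    exact h1.symm
  -- Orthogonality of `A γ` makes this pointwise Gram matrix invariant, hence constant; integrating
  -- finds the constants.
  let G (i k : ℕ) (y : Y) : ℝ := ∑ j, w i j y * w k j y
  have hG_const (i k : ℕ) : ∃ c, ∀ᵐ y ∂ν, G i k y = c := by
    refine exists_ae_eq_const_of_forall_smul_ae_eq (Γ := Γ) ?_ fun γ ↦ ?_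
    · refine AEMeasurable.nullMeasurable ?_
      refine Finset.aemeasurable_fun_sum _ fun j _ ↦ ?_
      exact (Lp.aestronglyMeasurable _).aemeasurable.mul (Lp.aestronglyMeasurable _).aemeasurable
    · filter_upwards [ae_all_iff.2 (hwae γ i), ae_all_iff.2 (hwae γ k)] with y h1 h2
      simp only [G, h1, h2]
      exact sum_mul_eq_of_orthogonal (horth γ) (fun l ↦ w i l y) (fun l ↦ w k l y)
  have hG_int (i k : ℕ) : ∫ y, G i k y ∂ν = ∑ j, inner ℝ (w i j) (w k j) := by
    simp only [G, L2.inner_def]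
    rw [← integral_finsetSum _ fun j _ ↦ L2.integrable_inner (𝕜 := ℝ) (w i j) (w k j)]
    refine integral_congr_ae (.of_forall fun y ↦ Finset.sum_congr rfl fun j _ ↦ ?_)
    rw [Real.inner_apply]
  have hw_norm (i : ℕ) (j : Fin d) : ‖w i j‖ = 1 := by
    induction i with
    | zero => exact e.orthonormal.1 j
    | succ i ih => simpa only [w, Function.iterate_succ_apply', U.norm_map] using ih
  have hG (i k : ℕ) : ∀ᵐ y ∂ν, G i k y = if i = k then (d : ℝ) else 0 := by
    obtain ⟨c, hc⟩ := hG_const i k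
    have h1 : ∫ y, G i k y ∂ν = c := by rw [integral_congr_ae hc]; simp
    rw [hG_int] at h1
    filter_upwards [hc] with y hy
    rw [hy, ← h1]
    split_ifs with h
    · subst h; simp [hw_norm]
    · exact Finset.sum_eq_zero fun j _ ↦ inner_iterate_eq_zero U hV (e j).2 (e j).2 h
  obtain ⟨y, hy⟩ := (ae_all_iff.2 fun i ↦ ae_all_iff.2 fun k ↦ hG i k).exists
  -- At this point the first `d + 1` copies give too many orthogonal vectors in `ℝᵈ`.
  have := card_le_of_sum_mul_eq (m := d + 1) (fun i j ↦ w i j y) (Nat.cast_ne_zero.2 hd0)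
    fun i k ↦ by simpa only [G, Fin.val_inj] using hy i k
  omega

/-! ### Composition operators on `L²` -/

/-- A measure preserving self-map of a standard Borel probability space is injective on a conull
set as soon as every square integrable function factors through it. -/
theorem exists_conull_injOn_of_surjective {Y : Type*} [MeasurableSpace Y] [StandardBorelSpace Y]
    {ν : Measure Y} [IsProbabilityMeasure ν] {τ : Y → Y} (hτ : MeasurePreserving τ ν ν)
    (hsurj : Function.Surjective (Lp.compMeasurePreserving τ hτ : Lp ℝ 2 ν → Lp ℝ 2 ν)) :
    ∃ Y₀ : Set Y, ν Y₀ᶜ = 0 ∧ InjOn τ Y₀ := by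
  -- The arctangent makes the embedding bounded, hence square integrable, and keeps it injective.
  let e : Y → ℝ := fun y ↦ Real.arctan (embeddingReal Y y)
  have he : Function.Injective e :=
    Real.arctan_injective.comp (measurableEmbedding_embeddingReal Y).injective
  have hmem : MemLp e 2 ν := by
    refine MemLp.of_bound
      (Real.measurable_arctan.comp (measurable_embeddingReal Y)).aestronglyMeasurable
      (Real.pi / 2) (.of_forall fun y ↦ ?_)
    exact abs_le.2 ⟨(Real.neg_pi_div_two_lt_arctan _).le, (Real.arctan_lt_pi_div_two _).le⟩
  obtain ⟨g, hg⟩ := hsurj (hmem.toLp e)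
  have hae : ∀ᵐ y ∂ν, g (τ y) = e y := by
    filter_upwards [Lp.coeFn_compMeasurePreserving g hτ, hmem.coeFn_toLp] with y h1 h2
    rw [hg, h2] at h1
    exact h1.symm
  refine ⟨{y | g (τ y) = e y}, hae, fun y hy y' hy' h ↦ he ?_⟩
  rw [← hy, ← hy', h]

theorem compMeasurePreserving_comm_of_ae_eq {A B C D : Type*} [MeasurableSpace A]
    [MeasurableSpace B] [MeasurableSpace C] [MeasurableSpace D] {a : Measure A} {b : Measure B}
    {c : Measure C} {d : Measure D} {f : A → B} {g : B → D} {f' : A → C} {g' : C → D}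
    (hf : MeasurePreserving f a b) (hg : MeasurePreserving g b d) (hf' : MeasurePreserving f' a c)
    (hg' : MeasurePreserving g' c d) (h : ∀ᵐ x ∂a, g (f x) = g' (f' x)) (φ : Lp ℝ 2 d) :
    Lp.compMeasurePreserving f hf (Lp.compMeasurePreserving g hg φ) =
      Lp.compMeasurePreserving f' hf' (Lp.compMeasurePreserving g' hg' φ) := by
  apply Lp.ext
  filter_upwards [h, Lp.coeFn_compMeasurePreserving (Lp.compMeasurePreserving g hg φ) hf,
    Lp.coeFn_compMeasurePreserving (Lp.compMeasurePreserving g' hg' φ) hf',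
    hf.quasiMeasurePreserving.ae (Lp.coeFn_compMeasurePreserving φ hg),
    hf'.quasiMeasurePreserving.ae (Lp.coeFn_compMeasurePreserving φ hg')] with x h0 h1 h2 h3 h4
  rw [h1, h2, Function.comp_apply, Function.comp_apply, h3, h4, Function.comp_apply,
    Function.comp_apply, h0]

theorem compMeasurePreserving_eq_self {A : Type*} [MeasurableSpace A] {a : Measure A} {f : A → A}
    (hf : MeasurePreserving f a a) (h : ∀ x, f x = x) (φ : Lp ℝ 2 a) :
    Lp.compMeasurePreserving f hf φ = φ := by
  obtain rfl : f = id := funext h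
  exact Lp.compMeasurePreserving_id_apply φ

/-- If a family of maps of `E` is intertwined by an isometry `J : E → F` with a dense part of a
continuous isometric representation of a compact group on `F`, then every nonzero closed subspace
of `E` invariant under the family contains a nonzero finite-dimensional such subspace. -/
theorem exists_finiteDimensional_invariant_le_of_intertwining {Γ E F H : Type*}
    [NormedAddCommGroup E] [InnerProductSpace ℝ E] [CompleteSpace E]
    [NormedAddCommGroup F] [InnerProductSpace ℝ F] [CompleteSpace F]
    [Group H] [TopologicalSpace H] [IsTopologicalGroup H] [CompactSpace H]
    (π : H →* (F →ₗᵢ[ℝ] F)) (hπ : ∀ v, Continuous fun h ↦ π h v) (J : E →ₗᵢ[ℝ] F)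
    {r : Γ → H} (hdense : DenseRange r) {κ : Γ → E → E} (hJ : ∀ γ f, π (r γ) (J f) = J (κ γ f))
    (W : Submodule ℝ E) (hW : IsClosed (W : Set E)) (hinv : ∀ γ, ∀ f ∈ W, κ γ f ∈ W)
    (hne : W ≠ ⊥) :
    ∃ V ≤ W, V ≠ ⊥ ∧ FiniteDimensional ℝ V ∧ ∀ γ, ∀ f ∈ V, κ γ f ∈ V := by
  have hJW : IsClosed (W.map J.toLinearMap : Set F) :=
    J.isometry.isClosedEmbedding.isClosedMap _ hW
  have hWinv (h : H) : ∀ x ∈ W.map J.toLinearMap, π h x ∈ W.map J.toLinearMap := by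
    rintro x hx
    -- Membership in the closed image of `W` is a closed condition on `h`.
    refine hdense.induction_on (p := fun h ↦ π h x ∈ W.map J.toLinearMap) h
      (hJW.preimage (hπ x)) fun γ ↦ ?_
    obtain ⟨f, hf, rfl⟩ := hx
    exact ⟨_, hinv γ f hf, (hJ γ f).symm⟩
  obtain ⟨V, hVW, hV0, hVf, hVinv⟩ := exists_finiteDimensional_invariant_le
    π hπ (W.map J.toLinearMap) hJW hWinv
    (fun h0 ↦ hne ((Submodule.map_injective_of_injective J.injective)
      (h0.trans (Submodule.map_bot _).symm)))
  have hmap : (V.comap J.toLinearMap).map J.toLinearMap = V := by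
    rw [Submodule.map_comap_eq, inf_eq_right]
    exact hVW.trans LinearMap.map_le_range
  refine ⟨V.comap J.toLinearMap, fun f hf ↦ ?_, fun h0 ↦ hV0 ?_, ?_, fun γ f hf ↦ ?_⟩
  · obtain ⟨g, hg, hgf⟩ := hVW hf
    rwa [← J.injective hgf]
  · rw [← hmap, h0, Submodule.map_bot]
  · have : FiniteDimensional ℝ ((V.comap J.toLinearMap).map J.toLinearMap) := by rwa [hmap]
    exact Module.Finite.of_injective
      (J.toLinearMap.restrict fun f (hf : f ∈ V.comap J.toLinearMap) ↦ (hf : J f ∈ V))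
      fun a b hab ↦ Subtype.ext (J.injective (congrArg Subtype.val hab))
  · have := hVinv (r γ) (J f) hf
    rw [hJ] at this
    exact this

/-! ### Transfer to the regular representation -/

/-- The left regular representation of a subgroup of a compact group `K` on the real `L²(K)`. -/
noncomputable def leftRegularRep {K : Type*} [Group K] [TopologicalSpace K] [IsTopologicalGroup K]
    [MeasurableSpace K] [BorelSpace K] (m : Measure K) [m.IsMulLeftInvariant] (H : Subgroup K) :
    H →* (Lp ℝ 2 m →ₗᵢ[ℝ] Lp ℝ 2 m) where
  toFun h := Lp.compMeasurePreservingₗᵢ ℝ ((h : K)⁻¹ * ·) (measurePreserving_mul_left m (h : K)⁻¹)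
  map_one' := by
    ext1 f
    exact compMeasurePreserving_eq_self _ (fun x ↦ by simp) f
  map_mul' g h := by
    ext1 f
    change Lp.compMeasurePreserving _ _ f =
      Lp.compMeasurePreserving _ _ (Lp.compMeasurePreserving _ _ f)
    rw [← Lp.compMeasurePreserving_comp_apply]
    congr 2
    ext x
    simp [mul_assoc]

theorem leftRegularRep_apply {K : Type*} [Group K] [TopologicalSpace K] [IsTopologicalGroup K]
    [MeasurableSpace K] [BorelSpace K] (m : Measure K) [m.IsMulLeftInvariant] (H : Subgroup K)
    (h : H) (f : Lp ℝ 2 m) : leftRegularRep m H h f =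
      Lp.compMeasurePreserving ((h : K)⁻¹ * ·) (measurePreserving_mul_left m (h : K)⁻¹) f :=
  rfl

theorem continuous_leftRegularRep {K : Type*} [Group K] [TopologicalSpace K] [IsTopologicalGroup K]
    [CompactSpace K] [MeasurableSpace K] [BorelSpace K] (m : Measure K) [m.IsMulLeftInvariant]
    [m.Regular] (H : Subgroup K) (f : Lp ℝ 2 m) : Continuous fun h ↦ leftRegularRep m H h f := by
  have : Fact ((2 : ENNReal) ≠ ⊤) := ⟨ENNReal.ofNat_ne_top⟩
  have : Continuous fun h : H ↦ DomMulAct.mk (h : K)⁻¹ • f :=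
    (DomMulAct.continuous_mk.comp continuous_subtype_val.inv).smul continuous_const
  exact this

/-- The quotient map `K → K ⧸ L` sends the Haar measure to the invariant measure. -/
theorem TranslationSpace.measurePreserving_mk {Γ K : Type*} [Group Γ] [Group K]
    [TopologicalSpace K] [IsTopologicalGroup K] [CompactSpace K] [MeasurableSpace K]
    [hK : BorelSpace K] (ρ : Γ →* K) (L : Subgroup K) :
    MeasurePreserving (TranslationSpace.mk ρ L)
      (Measure.haarMeasure (⊤ : TopologicalSpace.PositiveCompacts K))
      (TranslationSpace.invariantMeasure ρ L) := by
  have hc : Continuous (TranslationSpace.mk ρ L) := continuous_quotient_mk'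
  have : BorelSpace (TranslationSpace ρ L) := ⟨rfl⟩
  refine ⟨hc.measurable, ?_⟩
  obtain rfl := hK.measurable_eq
  rw [TranslationSpace.invariantMeasure]

theorem TranslationSpace.smul_mk {Γ K : Type*} [Group Γ] [Group K] (ρ : Γ →* K) (L : Subgroup K)
    (γ : Γ) (k : K) : γ • TranslationSpace.mk ρ L k = TranslationSpace.mk ρ L (ρ γ * k) :=
  rfl

/-- In a factor of a compact translation action, every nonzero closed invariant subspace of `L²`
contains a nonzero finite-dimensional invariant subspace. -/
theorem IsFactor.exists_finiteDimensional_invariant_le {Γ Y K : Type*} [Group Γ] [MulAction Γ Y]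
    [MeasurableSpace Y] {ν : Measure Y} [Group K] [TopologicalSpace K] [IsTopologicalGroup K]
    [CompactSpace K] {ρ : Γ →* K} {L : Subgroup K}
    (h : IsFactor Γ ν (TranslationSpace.invariantMeasure ρ L))
    (hsm : ∀ γ : Γ, MeasurePreserving (γ • · : Y → Y) ν ν)
    (W : Submodule ℝ (Lp ℝ 2 ν)) (hW : IsClosed (W : Set (Lp ℝ 2 ν)))
    (hinv : ∀ γ, ∀ f ∈ W, Lp.compMeasurePreserving _ (hsm γ) f ∈ W) (hne : W ≠ ⊥) :
    ∃ V ≤ W, V ≠ ⊥ ∧ FiniteDimensional ℝ V ∧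
      ∀ γ, ∀ f ∈ V, Lp.compMeasurePreserving _ (hsm γ) f ∈ V := by
  obtain ⟨ψ, hψ, hψe⟩ := h
  borelize K
  let m : Measure K := Measure.haarMeasure (⊤ : TopologicalSpace.PositiveCompacts K)
  have hmk : MeasurePreserving (TranslationSpace.mk ρ L) m
      (TranslationSpace.invariantMeasure ρ L) := TranslationSpace.measurePreserving_mk ρ L
  let q : K → Y := ψ ∘ TranslationSpace.mk ρ L
  have hq : MeasurePreserving q m ν := hψ.comp hmk
  have hqe (γ : Γ) : ∀ᵐ k ∂m, γ • q k = q (ρ γ * k) := by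
    filter_upwards [hmk.quasiMeasurePreserving.ae (hψe γ)] with k hk
    rw [TranslationSpace.smul_mk] at hk
    exact hk.symm
  let J : Lp ℝ 2 ν →ₗᵢ[ℝ] Lp ℝ 2 m := Lp.compMeasurePreservingₗᵢ ℝ q hq
  -- The image of `W` in `L²(K)` is invariant under `ρ(Γ)`, so only under its closure in general,
  -- not under `K`.
  let H : Subgroup K := ρ.range.topologicalClosure
  have : CompactSpace H := isCompact_iff_compactSpace.1
    ρ.range.isClosed_topologicalClosure.isCompact
  let r (γ : Γ) : H := ⟨ρ γ, ρ.range.le_topologicalClosure ⟨γ, rfl⟩⟩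
  -- The inverse matches the one in `leftRegularRep`.
  have hJ (γ : Γ) (f : Lp ℝ 2 ν) :
      leftRegularRep m H (r γ) (J f) = J (Lp.compMeasurePreserving _ (hsm γ⁻¹) f) := by
    have hJ_apply (g : Lp ℝ 2 ν) : J g = Lp.compMeasurePreserving q hq g := rfl
    rw [leftRegularRep_apply, hJ_apply, hJ_apply]
    refine compMeasurePreserving_comm_of_ae_eq _ hq hq (hsm γ⁻¹) ?_ f
    filter_upwards [hqe γ⁻¹] with k hk
    simp only [hk, map_inv, r]
  have hdense : DenseRange r := by
    rw [DenseRange, Subtype.dense_iff, ← range_comp]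
    exact fun x hx ↦ hx
  obtain ⟨V, hVW, hV0, hVf, hVinv⟩ := exists_finiteDimensional_invariant_le_of_intertwining
    (leftRegularRep m H) (continuous_leftRegularRep m H) J hdense hJ W hW (fun γ ↦ hinv γ⁻¹) hne
  refine ⟨V, hVW, hV0, hVf, fun γ f hf ↦ ?_⟩
  simpa only [inv_inv] using hVinv γ⁻¹ f hf

/-! ### Coalescence and the conclusion -/

/-- Ergodic compact actions are coalescent: every equivariant measure preserving self-map is
injective on a conull set. -/
theorem IsFactorMap.exists_conull_injOn {Γ : Type*} [Group Γ] {Y : Type*} [MeasurableSpace Y]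
    [StandardBorelSpace Y] [MulAction Γ Y] [MeasurableConstSMul Γ Y] {ν : Measure Y}
    [IsProbabilityMeasure ν] [ErgodicSMul Γ Y ν] (hcpt : IsCompactAction Γ ν) {τ : Y → Y}
    (hτ : IsFactorMap Γ ν ν τ) : ∃ Y₀ : Set Y, ν Y₀ᶜ = 0 ∧ InjOn τ Y₀ := by
  have hsm (γ : Γ) : MeasurePreserving (γ • · : Y → Y) ν ν := measurePreserving_smul γ ν
  obtain ⟨K, _, _, _, _, _, L, _, ρ, ψ, hψ, -⟩ := hcpt
  let U : Lp ℝ 2 ν →ₗᵢ[ℝ] Lp ℝ 2 ν := Lp.compMeasurePreservingₗᵢ ℝ τ hτ.measurePreserving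
  have hU (γ : Γ) (f : Lp ℝ 2 ν) :
      U (Lp.compMeasurePreserving _ (hsm γ) f) = Lp.compMeasurePreserving _ (hsm γ) (U f) :=
    compMeasurePreserving_comm_of_ae_eq hτ.measurePreserving (hsm γ) (hsm γ) hτ.measurePreserving
      ((hτ.equivariant γ).mono fun y hy ↦ hy.symm) f
  refine exists_conull_injOn_of_surjective hτ.measurePreserving ?_
  by_contra hns
  have hclosed : IsClosed (LinearMap.range U.toLinearMap : Set (Lp ℝ 2 ν)) :=
    U.isometry.isClosedEmbedding.isClosed_range
  have : CompleteSpace (LinearMap.range U.toLinearMap) := hclosed.completeSpace_coe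
  have hne : (LinearMap.range U.toLinearMap)ᗮ ≠ ⊥ := fun h ↦
    hns (LinearMap.range_eq_top.1 ((Submodule.orthogonal_eq_bot_iff).1 h))
  have hinv (γ : Γ) (f : Lp ℝ 2 ν) (hf : f ∈ (LinearMap.range U.toLinearMap)ᗮ) :
      Lp.compMeasurePreserving _ (hsm γ) f ∈ (LinearMap.range U.toLinearMap)ᗮ := by
    rw [Submodule.mem_orthogonal] at hf ⊢
    rintro _ ⟨g, rfl⟩
    -- As `γ` is invertible, each element of the range is a `γ`-translate of another, so the
    -- translation can be cancelled in the inner product.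
    have h1 : U g = Lp.compMeasurePreserving _ (hsm γ)
        (U (Lp.compMeasurePreserving _ (hsm γ⁻¹) g)) := by
      rw [← hU, ← Lp.compMeasurePreserving_comp_apply,
        compMeasurePreserving_eq_self _ fun y ↦ by simp]
    change inner ℝ (U g) _ = 0
    rw [h1]
    exact ((Lp.compMeasurePreservingₗᵢ ℝ _ (hsm γ)).inner_map_map _ _).trans
      (hf _ (LinearMap.mem_range_self U.toLinearMap _))
  obtain ⟨V, hVW, hV0, _, hVinv⟩ := IsFactor.exists_finiteDimensional_invariant_le ⟨ψ, hψ⟩ hsm _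
    (Submodule.isClosed_orthogonal _) hinv hne
  exact hV0 (eq_bot_of_le_orthogonal_range hsm U hU V hVW hVinv)

theorem IsFactorMap.comp {Γ X Y Z : Type*} [SMul Γ X] [SMul Γ Y] [SMul Γ Z] [MeasurableSpace X]
    [MeasurableSpace Y] [MeasurableSpace Z] {μ : Measure X} {ν : Measure Y} {η : Measure Z}
    {φ : Y → X} {θ : Z → Y} (hφ : IsFactorMap Γ μ ν φ) (hθ : IsFactorMap Γ ν η θ) :
    IsFactorMap Γ μ η (φ ∘ θ) where
  measurePreserving := hφ.measurePreserving.comp hθ.measurePreserving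
  equivariant γ := by
    filter_upwards [hθ.equivariant γ,
      hθ.measurePreserving.quasiMeasurePreserving.ae (hφ.equivariant γ)] with z h1 h2
    rw [Function.comp_apply, h1, h2, Function.comp_apply]

theorem lemma2p7 {Γ : Type u} [Group Γ] [Countable Γ]
    {X : Type v} [MeasurableSpace X] [StandardBorelSpace X] [MulAction Γ X]
    [MeasurableConstSMul Γ X] (μ : Measure X) [IsProbabilityMeasure μ]
    {Y : Type w} [MeasurableSpace Y] [StandardBorelSpace Y] [MulAction Γ Y]
    [MeasurableConstSMul Γ Y] (ν : Measure Y) [IsProbabilityMeasure ν]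
    (hμ_erg : ErgodicSMul Γ X μ) (hν_erg : ErgodicSMul Γ Y ν)
    (hμ_cpt : IsCompactAction.{u, v, k₁} Γ μ) (hν_cpt : IsCompactAction.{u, w, k₂} Γ ν)
    (h : IsWeaklyIsomorphic Γ μ ν) :
    IsIsomorphic Γ μ ν := by
  obtain ⟨⟨θ, hθ⟩, ⟨φ, hφ⟩⟩ := h
  obtain ⟨Y₀, hY₀, hinj⟩ := (hφ.comp hθ).exists_conull_injOn hν_cpt
  exact ⟨θ, hθ, Y₀, hY₀, fun y hy y' hy' hyy' ↦ hinj hy hy' (congrArg φ hyy')⟩
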